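/- All graphs are finite, simple, undirected and have at least one vertex. A search tree on a connected graph $G$ is a rooted tree with vertex set $V(G)$ defined recursively: its root is a vertex $r\in V(G)$, and the children of $r$ are the roots of search trees on the connected components of $G-r$. Let $T$ be a search tree on $G$ and let $v$ be a child of $u$ in $T$. The rotation of $u$ and $v$ turns $T$ into the search tree $T'$ on $G$ in which $v$ takes the place of $u$ (it becomes a child of the parent of $u$, or the root if $u$ was the root), $u$ is a child of $v$, every subtree of $u$ in $T$ other than the one rooted at $v$ remains a subtree of $u$, and every subtree of $v$ in $T$ becomes a subtree of $u$ if it contains a vertex adjacent to $u$ in $G$ and remains a subtree of $v$ otherwise. The rotation graph $\mathcal R(G)$ has the search trees on $G$ as its vertices, two of them being adjacent if and only if they differ by one rotation. For $v\in V(G)$, let $\widetilde G_v$ be the graph obtained from $G$ by adding a false twin of $v$, that is, $V(\widetilde G_v)=V(G)\cup\{v'\}$ with $v'\notin V(G)$ and $E(\widetilde G_v)=E(G)\cup\{uv' : u\in N_G(v)\}$. **Proposition.** Let $G$ be a connected graph that is not complete, and let $V_1,V_2$ be a partition of $V(G)$ such that $N_G(u)=V_2$ for all $u\in V_1$. Let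 $v\in V_1$. Then $\chi(\mathcal R(\widetilde G_v))=\chi(\mathcal R(G))$. -/

import Mathlib

/-- A rooted tree on (a subset of) `V` is encoded by its parent function `parent : V → Option V`,
the root being sent to `none`. `IsSearchTreeOn G parent S r` says that the tree encoded by `parent`
is, on the vertex set `S`, a search tree with root `r` on the induced subgraph `G[S]`: the root `r`
is a vertex of `S`, and the children of `r` are the roots of search trees on each of the connected
components of `G[S] - r`. -/
inductive IsSearchTreeOn {V : Type*} (G : SimpleGraph V) (parent : V → Option V) :
    Set V → V → Prop
  | intro (S : Set V) (r : V) (hr : r ∈ S)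
      (root : (G.induce (S \ {r})).ConnectedComponent → V)
      (parent_root : ∀ K, parent (root K) = some r)
      (subtree : ∀ K, IsSearchTreeOn G parent (Subtype.val '' K.supp) (root K)) :
      IsSearchTreeOn G parent S r

/-- Search trees on a (connected) graph `G`: rooted trees with vertex set `V(G)` satisfying the
recursive condition of `IsSearchTreeOn` on the whole of `V(G)`. -/
@[ext]
structure SearchTree {V : Type*} (G : SimpleGraph V) where
  /-- the parent of each vertex, `none` for the root -/
  parent : V → Option V
  isSearchTree : ∃ r, parent r = none ∧ IsSearchTreeOn G parent Set.univ r

/-- `x` is a vertex of the subtree rooted at `w` of the tree encoded by `parent`. -/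
def InSubtree {V : Type*} (parent : V → Option V) (w x : V) : Prop :=
  Relation.ReflTransGen (fun a b => parent b = some a) w x

open Classical in
/-- The parent function after the rotation of `u` and its child `v`: `v` takes the place of `u`,
`u` becomes a child of `v`, those subtrees of `v` which contain a vertex adjacent to `u` in `G`
become subtrees of `u`, and everything else keeps its parent. -/
noncomputable def rotateParent {V : Type*} (G : SimpleGraph V) (parent : V → Option V) (u v : V) :
    V → Option V := fun w =>
  if w = u then some v
  else if w = v then parent u
  else if parent w = some v ∧ ∃ x, InSubtree parent w x ∧ G.Adj u x then some u
  else parent w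

/-- `T'` is obtained from `T` by one rotation. -/
def SearchTree.Rotates {V : Type*} {G : SimpleGraph V} (T T' : SearchTree G) : Prop :=
  ∃ u v, T.parent v = some u ∧ T'.parent = rotateParent G T.parent u v

/-- The rotation graph of `G`: the vertices are the search trees on `G`, and two (distinct) search
trees are adjacent when one is obtained from the other by one rotation. -/
def rotationGraph {V : Type*} (G : SimpleGraph V) : SimpleGraph (SearchTree G) :=
  SimpleGraph.fromRel SearchTree.Rotates

/-- The graph obtained from `G` by adding a false twin `none` of the vertex `v`: the edges are those
of `G` together with the edges joining `none` to the neighbours of `v`. -/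
def addFalseTwin {V : Type*} (G : SimpleGraph V) (v : V) : SimpleGraph (Option V) where
  Adj
    | some a, some b => G.Adj a b
    | some a, none => G.Adj v a
    | none, some b => G.Adj v b
    | none, none => False
  symm := ⟨by
    rintro (_ | a) (_ | b) h
    · exact h
    · exact h
    · exact h
    · exact G.adj_symm h⟩
  loopless := ⟨by
    rintro (_ | a) h
    · exact h
    · exact G.loopless.irrefl a h⟩

/-! Search trees on a connected graph are handled through their ancestor relation: everything lies
below the root, adjacent vertices are comparable, and below each child of `w` there is a neighbour
of `w` (`SearchTree.isElimTree`, `IsElimTree.toSearchTree`).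

One inequality is an embedding: putting the twin `none` above the root turns search trees on `G`
into search trees on the twinned graph and preserves rotations, so a colouring of the larger
rotation graph restricts to the smaller one.

For the other, let `B` be the common neighbourhood of `v` and `none`. Every vertex outside `B` is
adjacent to exactly `B`, which forces the following: if `v` is not above `none`, then `none` has at
most one child, that child is above `v`, and so is every proper ancestor of `none`. Hence `none` can
be spliced out, leaving a search tree on `G`. In general the upper twin is spliced out and the lower
one is called `v`. A rotation upstairs then has one of two effects (`twinRel_rotateParent`). Either
the spliced tree is rotated and the index `twinIndex`, with values in {0, 1, 2}, is kept; or the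
spliced tree is kept and the index changes, because the upper twin moved by one level, the twins
became or ceased to be comparable, or they exchanged places. So the colour of the spliced tree plus
the index, modulo k, is a proper colouring whenever k is at least 3.

That no fewer than three colours suffice for `G` follows from non-completeness: two nonadjacent
vertices with a common neighbour, the three dominating the graph, yield a 5-cycle of rotations
(`three_le_of_colorable`). -/

/-! ### The ancestor relation of a parent function. -/

namespace InSubtree

variable {V : Type*} {p : V → Option V} {w x y z : V}

theorem refl (p : V → Option V) (x : V) : InSubtree p x x := Relation.ReflTransGen.refl

theorem trans (h : InSubtree p x y) (h' : InSubtree p y z) : InSubtree p x z :=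
  Relation.ReflTransGen.trans h h'

theorem tail (h : InSubtree p x y) (h' : p z = some y) : InSubtree p x z :=
  Relation.ReflTransGen.tail h h'

theorem of_parent (h : p y = some x) : InSubtree p x y := Relation.ReflTransGen.single h

theorem eq_or_parent (h : InSubtree p x y) : x = y ∨ ∃ c, p y = some c ∧ InSubtree p x c := by
  rcases Relation.ReflTransGen.cases_tail h with h | ⟨c, h, hc⟩
  · exact Or.inl h.symm
  · exact Or.inr ⟨c, hc, h⟩

theorem to_parent (h : InSubtree p x y) (hne : x ≠ y) (hy : p y = some z) : InSubtree p x z := by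
  obtain h | ⟨c, hc, h⟩ := h.eq_or_parent
  · exact absurd h hne
  · rw [hy] at hc
    obtain rfl := Option.some.inj hc
    exact h

theorem eq_or_child (h : InSubtree p x y) : x = y ∨ ∃ c, p c = some x ∧ InSubtree p c y := by
  rcases Relation.ReflTransGen.cases_head h with h | ⟨c, hc, h⟩
  · exact Or.inl h
  · exact Or.inr ⟨c, hc, h⟩

theorem total (hx : InSubtree p x z) (hy : InSubtree p y z) :
    InSubtree p x y ∨ InSubtree p y x := by
  induction hx with
  | refl => exact Or.inr hy
  | tail hb hc ih =>
    obtain rfl | ⟨d, hd, hy⟩ := hy.eq_or_parent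
    · exact Or.inl (Relation.ReflTransGen.tail hb hc)
    · rw [hc] at hd
      obtain rfl := Option.some.inj hd
      exact ih hy

end InSubtree

/-! ### Search trees as elimination trees. -/

/-- A description of search trees through the ancestor relation: all vertices descend from the
root, adjacent vertices are comparable, and the subtree rooted at a child of `w` contains a
neighbour of `w`. -/
structure IsElimTree {V : Type*} (G : SimpleGraph V) (p : V → Option V) : Prop where
  root : ∃ r, p r = none ∧ ∀ x, InSubtree p r x
  comparable : ∀ x y, G.Adj x y → InSubtree p x y ∨ InSubtree p y x
  exists_adj : ∀ x w, p x = some w → ∃ y, InSubtree p x y ∧ G.Adj w y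

namespace IsElimTree

variable {V : Type*} {G : SimpleGraph V} {p : V → Option V} {w x y z : V}

theorem not_parent (h : IsElimTree G p) (hy : p y = some x) : ¬ InSubtree p y x := by
  obtain ⟨r, hr, hall⟩ := h.root
  suffices H : ∀ z, InSubtree p r z → ∀ c, p z = some c → ¬ InSubtree p z c from H y (hall y) x hy
  intro z hz
  induction hz with
  | refl => intro c hc; rw [hr] at hc; cases hc
  | tail _ hb ih =>
    intro c hc hcc
    rw [hb] at hc
    obtain rfl := Option.some.inj hc
    obtain rfl | ⟨d, hd, h'⟩ := hcc.eq_or_parent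
    · exact ih _ hb (InSubtree.refl _ _)
    · exact ih d hd ((InSubtree.of_parent hb).trans h')

theorem antisymm (h : IsElimTree G p) (hxy : InSubtree p x y) (hyx : InSubtree p y x) : x = y := by
  by_contra hne
  obtain h1 | ⟨c, hc, h1⟩ := hxy.eq_or_parent
  · exact hne h1
  · exact h.not_parent hc (hyx.trans h1)

theorem parent_ne (h : IsElimTree G p) (hy : p y = some x) : x ≠ y := by
  rintro rfl
  exact h.not_parent hy (InSubtree.refl _ _)

/-- Comparable children of the same vertex are equal. -/
theorem eq_of_siblings (h : IsElimTree G p) (hx : p x = some w) (hy : p y = some w)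
    (hxy : InSubtree p x y) : x = y := by
  by_contra hne
  exact h.not_parent hx (hxy.to_parent hne hy)

theorem ncard_lt [Finite V] (h : IsElimTree G p) (hy : p y = some x) :
    {z | InSubtree p y z}.ncard < {z | InSubtree p x z}.ncard := by
  apply Set.ncard_lt_ncard _ (Set.toFinite _)
  refine ⟨fun z hz => (InSubtree.of_parent hy).trans hz, fun hle => ?_⟩
  exact h.not_parent hy (hle (InSubtree.refl p x))

theorem reachable [Finite V] (h : IsElimTree G p) (w x : V) (hx : InSubtree p w x) :
    (G.induce {z | InSubtree p w z}).Reachable ⟨w, InSubtree.refl _ _⟩ ⟨x, hx⟩ := by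
  induction hn : {z | InSubtree p w z}.ncard using Nat.strong_induction_on generalizing w x with
  | _ n ih =>
    subst hn
    obtain rfl | ⟨c, hc, hcx⟩ := hx.eq_or_child
    · exact SimpleGraph.Reachable.refl _
    · obtain ⟨y, hy, hwy⟩ := h.exists_adj c w hc
      have hle : {z | InSubtree p c z} ≤ {z | InSubtree p w z} :=
        fun z hz => (InSubtree.of_parent hc).trans hz
      have h1 := (ih _ (h.ncard_lt hc) c x hcx rfl).map (SimpleGraph.induceHomOfLE G hle).toHom
      have h2 := (ih _ (h.ncard_lt hc) c y hy rfl).map (SimpleGraph.induceHomOfLE G hle).toHom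
      have h3 : (G.induce {z | InSubtree p w z}).Adj ⟨w, InSubtree.refl _ _⟩ ⟨y, hle hy⟩ := hwy
      exact h3.reachable.trans (h2.symm.trans h1)

/-- The components left after removing `w` from its subtree are the subtrees of its children: each
of these is connected by `reachable`, and comparability of adjacent vertices forbids edges between
two of them. -/
theorem isSearchTreeOn [Finite V] (h : IsElimTree G p) (w : V) :
    IsSearchTreeOn G p {z | InSubtree p w z} w := by
  induction hn : {z | InSubtree p w z}.ncard using Nat.strong_induction_on generalizing w with
  | _ n ih =>
    subst hn
    have key : ∀ K : (G.induce ({z | InSubtree p w z} \ {w})).ConnectedComponent,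
        ∃ c, p c = some w ∧ Subtype.val '' K.supp = {z | InSubtree p c z} := by
      intro K
      obtain ⟨⟨x, hx, hxw⟩, hxK⟩ := K.nonempty_supp
      obtain rfl | ⟨c, hc, hcx⟩ := InSubtree.eq_or_child hx
      · exact absurd rfl hxw
      refine ⟨c, hc, ?_⟩
      have hle : {z | InSubtree p c z} ≤ {z | InSubtree p w z} \ {w} := by
        intro z hz
        refine ⟨(InSubtree.of_parent hc).trans hz, ?_⟩
        rintro rfl
        exact h.not_parent hc hz
      ext z
      constructor
      · rintro ⟨⟨z, hz⟩, hzK, rfl⟩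
        by_contra hcz
        have hr := SimpleGraph.ConnectedComponent.exact
          (((SimpleGraph.ConnectedComponent.mem_supp_iff _ _).1 hxK).trans
            ((SimpleGraph.ConnectedComponent.mem_supp_iff _ _).1 hzK).symm)
        obtain ⟨W⟩ := hr
        -- An edge leaving the subtree of `c` would end in a proper ancestor of `c`, hence in an
        -- ancestor of `w`; inside the subtree of `w` this can only be `w`, which was removed.
        obtain ⟨d, -, hd1, hd2⟩ := W.exists_boundary_dart {y | InSubtree p c y.1} hcx hcz
        have hadj : G.Adj d.fst.1 d.snd.1 := d.adj
        obtain h1 | h1 := h.comparable _ _ hadj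
        · exact hd2 (InSubtree.trans hd1 h1)
        · obtain h2 | h2 := InSubtree.total hd1 h1
          · exact hd2 h2
          · by_cases hdc : d.snd.1 = c
            · exact hd2 (hdc ▸ InSubtree.refl p c)
            · exact d.snd.2.2 (h.antisymm (h2.to_parent hdc hc) d.snd.2.1)
      · intro hz
        refine ⟨⟨z, hle hz⟩, ?_, rfl⟩
        have h1 := (h.reachable c x hcx).map (SimpleGraph.induceHomOfLE G hle).toHom
        have h2 := (h.reachable c z hz).map (SimpleGraph.induceHomOfLE G hle).toHom
        rw [SimpleGraph.ConnectedComponent.mem_supp_iff] at hxK ⊢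
        rw [← hxK]
        exact SimpleGraph.ConnectedComponent.sound (h2.symm.trans h1)
    choose root hroot hsupp using key
    refine IsSearchTreeOn.intro _ w (InSubtree.refl _ _) root hroot fun K => ?_
    rw [hsupp]
    exact ih _ (h.ncard_lt (hroot K)) _ rfl

end IsElimTree

/-- Edges avoiding `r` stay inside one component, which gives comparability by induction.
Connectedness of `S` gives the last clause: each component must send an edge to `r`. -/
theorem IsSearchTreeOn.elim {V : Type*} {G : SimpleGraph V} {p : V → Option V} {S : Set V} {r : V}
    (h : IsSearchTreeOn G p S r) (hS : (G.induce S).Connected) :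
    (∀ x ∈ S, InSubtree p r x) ∧
    (∀ x ∈ S, ∀ y ∈ S, G.Adj x y → InSubtree p x y ∨ InSubtree p y x) ∧
    ∀ x ∈ S, x ≠ r → ∃ w y, p x = some w ∧ InSubtree p x y ∧ G.Adj w y := by
  induction h with
  | intro S r hr root hroot hsub ih =>
    have hconn : ∀ K : (G.induce (S \ {r})).ConnectedComponent,
        (G.induce (Subtype.val '' K.supp)).Connected := by
      intro K
      let f : K.toSimpleGraph →g G.induce (Subtype.val '' K.supp) :=
        ⟨fun x => ⟨x.1.1, x.1, x.2, rfl⟩, fun {a b} hab => hab⟩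
      refine K.connected_toSimpleGraph.map f ?_
      rintro ⟨_, x, hx, rfl⟩
      exact ⟨⟨x, hx⟩, rfl⟩
    have ih' := fun K => ih K (hconn K)
    have hmem : ∀ x (hx : x ∈ S) (hxr : x ≠ r),
        ∃ K : (G.induce (S \ {r})).ConnectedComponent, x ∈ Subtype.val '' K.supp :=
      fun x hx hxr => ⟨SimpleGraph.connectedComponentMk _ ⟨x, hx, hxr⟩, ⟨x, hx, hxr⟩, rfl, rfl⟩
    have hreach : ∀ x ∈ S, InSubtree p r x := by
      intro x hx
      by_cases hxr : x = r
      · rw [hxr]; exact InSubtree.refl _ _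
      · obtain ⟨K, hK⟩ := hmem x hx hxr
        exact (InSubtree.of_parent (hroot K)).trans ((ih' K).1 x hK)
    have hclosed : ∀ (K : (G.induce (S \ {r})).ConnectedComponent) (x y : V),
        x ∈ Subtype.val '' K.supp → y ∈ S → y ≠ r → G.Adj x y → y ∈ Subtype.val '' K.supp := by
      rintro K _ y ⟨x, hx, rfl⟩ hy hyr hxy
      refine ⟨⟨y, hy, hyr⟩, ?_, rfl⟩
      have hadj : (G.induce (S \ {r})).Adj x ⟨y, hy, hyr⟩ := hxy
      rw [SimpleGraph.ConnectedComponent.mem_supp_iff] at hx ⊢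
      rw [← hx]
      exact SimpleGraph.ConnectedComponent.sound hadj.symm.reachable
    refine ⟨hreach, ?_, ?_⟩
    · intro x hx y hy hxy
      by_cases hxr : x = r
      · rw [hxr]; exact Or.inl (hreach y hy)
      by_cases hyr : y = r
      · rw [hyr]; exact Or.inr (hreach x hx)
      obtain ⟨K, hK⟩ := hmem x hx hxr
      exact (ih' K).2.1 x hK y (hclosed K x y hK hy hyr hxy) hxy
    · intro x hx hxr
      obtain ⟨K, hK⟩ := hmem x hx hxr
      by_cases hxK : x = root K
      · obtain ⟨W⟩ := hS.preconnected ⟨x, hx⟩ ⟨r, hr⟩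
        obtain ⟨d, -, hd1, hd2⟩ := W.exists_boundary_dart
          {z | z.1 ∈ Subtype.val '' K.supp} hK (by
            rintro ⟨z, -, hz⟩
            exact z.2.2 hz)
        have hadj : G.Adj d.fst.1 d.snd.1 := d.adj
        have hdr : d.snd.1 = r := by
          by_contra hdr
          exact hd2 (hclosed K _ _ hd1 d.snd.2 hdr hadj)
        refine ⟨r, d.fst.1, hxK ▸ hroot K, hxK ▸ (ih' K).1 _ hd1, ?_⟩
        rw [← hdr]
        exact hadj.symm
      · exact (ih' K).2.2 x hK hxK

/-- The search trees on a connected graph are its elimination trees. -/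
theorem SearchTree.isElimTree {V : Type*} {G : SimpleGraph V} (hG : G.Connected)
    (T : SearchTree G) : IsElimTree G T.parent := by
  obtain ⟨r, hr, hT⟩ := T.isSearchTree
  have hS : (G.induce Set.univ).Connected := by
    refine hG.map (⟨fun x => ⟨x, trivial⟩, fun {a b} hab => hab⟩ : G →g G.induce Set.univ) ?_
    rintro ⟨x, -⟩
    exact ⟨x, rfl⟩
  obtain ⟨h1, h2, h3⟩ := hT.elim hS
  refine ⟨⟨r, hr, fun x => h1 x trivial⟩, fun x y => h2 x trivial y trivial, ?_⟩
  intro x w hx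
  obtain ⟨w', y, hw, hy⟩ := h3 x trivial (by rintro rfl; rw [hr] at hx; cases hx)
  rw [hx] at hw
  obtain rfl := Option.some.inj hw
  exact ⟨y, hy⟩

/-- The search tree given by an elimination tree. -/
def IsElimTree.toSearchTree {V : Type*} [Finite V] {G : SimpleGraph V} {p : V → Option V}
    (h : IsElimTree G p) : SearchTree G where
  parent := p
  isSearchTree := by
    obtain ⟨r, hr, hall⟩ := h.root
    refine ⟨r, hr, ?_⟩
    have huniv : {z | InSubtree p r z} = Set.univ := Set.eq_univ_of_forall hall
    rw [← huniv]
    exact h.isSearchTreeOn r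

/-- The inequality in `fromRel` is automatic: a rotation fixing the tree would make `u` both parent
and child of `v`. -/
theorem rotationGraph_adj {V : Type*} {G : SimpleGraph V} (hG : G.Connected)
    {T T' : SearchTree G} :
    (rotationGraph G).Adj T T' ↔ T.Rotates T' ∨ T'.Rotates T := by
  have hne : ∀ T T' : SearchTree G, T.Rotates T' → T ≠ T' := by
    rintro T _ ⟨u, v, hv, h⟩ rfl
    have hu : T.parent u = some v := by rw [h]; simp [rotateParent]
    exact (T.isElimTree hG).not_parent hv (InSubtree.of_parent hu)
  rw [rotationGraph, SimpleGraph.fromRel_adj]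
  constructor
  · exact fun h => h.2
  · rintro (h | h)
    · exact ⟨hne _ _ h, Or.inl h⟩
    · exact ⟨(hne _ _ h).symm, Or.inr h⟩

/-! ### Effect of a rotation on subtrees. -/

section Rotate

variable {V : Type*} {G : SimpleGraph V} {p : V → Option V} {a b w x : V}

theorem rotateParent_fst : rotateParent G p a b a = some b := by simp [rotateParent]

theorem rotateParent_snd (hab : a ≠ b) : rotateParent G p a b b = p a := by
  simp [rotateParent, hab.symm]

theorem rotateParent_of_adj (ha : w ≠ a) (hb : w ≠ b) (hw : p w = some b)
    (h : ∃ x, InSubtree p w x ∧ G.Adj a x) : rotateParent G p a b w = some a := by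
  simp only [rotateParent, if_neg ha, if_neg hb, if_pos (And.intro hw h)]

theorem rotateParent_of_not_adj (ha : w ≠ a) (hb : w ≠ b)
    (h : ¬ ∃ x, InSubtree p w x ∧ G.Adj a x) : rotateParent G p a b w = p w := by
  simp only [rotateParent, if_neg ha, if_neg hb, if_neg (fun h' => h (And.right h'))]

theorem rotateParent_of_ne (ha : w ≠ a) (hb : w ≠ b) (hw : p w ≠ some b) :
    rotateParent G p a b w = p w := by
  simp only [rotateParent, if_neg ha, if_neg hb, if_neg (fun h' => hw (And.left h'))]

/-- Only `a` and `b` change their sets of descendants: any other vertex that is above one of them is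
above both, before and after. -/
theorem inSubtree_rotateParent_of_ne (hab : a ≠ b) (hb : p b = some a) (hwa : w ≠ a)
    (hwb : w ≠ b) : InSubtree (rotateParent G p a b) w x ↔ InSubtree p w x := by
  constructor
  · intro h
    induction h with
    | refl => exact InSubtree.refl _ _
    | @tail y z _ hz ih =>
      by_cases hza : z = a
      · subst hza
        rw [rotateParent_fst] at hz
        obtain rfl := Option.some.inj hz
        exact ih.to_parent hwb hb
      by_cases hzb : z = b
      · subst hzb
        rw [rotateParent_snd hab] at hz
        exact (ih.tail hz).tail hb
      by_cases hc : p z = some b ∧ ∃ x, InSubtree p z x ∧ G.Adj a x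
      · rw [rotateParent_of_adj hza hzb hc.1 hc.2] at hz
        obtain rfl := Option.some.inj hz
        exact (ih.tail hb).tail hc.1
      · simp only [rotateParent, if_neg hza, if_neg hzb, if_neg hc] at hz
        exact ih.tail hz
  · intro h
    induction h with
    | refl => exact InSubtree.refl _ _
    | @tail y z _ hz ih =>
      by_cases hza : z = a
      · subst hza
        exact (ih.tail (by rw [rotateParent_snd hab, hz])).tail rotateParent_fst
      by_cases hzb : z = b
      · subst hzb
        rw [hb] at hz
        obtain rfl := Option.some.inj hz
        exact ih.to_parent hwa rotateParent_fst
      by_cases hc : p z = some b ∧ ∃ x, InSubtree p z x ∧ G.Adj a x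
      · rw [hc.1] at hz
        obtain rfl := Option.some.inj hz
        exact (ih.tail rotateParent_fst).tail (rotateParent_of_adj hza hzb hc.1 hc.2)
      · refine ih.tail ?_
        simp only [rotateParent, if_neg hza, if_neg hzb, if_neg hc]
        exact hz

theorem inSubtree_rotateParent_snd (hab : a ≠ b) (hb : p b = some a) :
    InSubtree (rotateParent G p a b) b x ↔ InSubtree p a x := by
  constructor
  · intro h
    induction h with
    | refl => exact InSubtree.of_parent hb
    | @tail y z _ hz ih =>
      by_cases hza : z = a
      · subst hza
        exact InSubtree.refl _ _
      by_cases hzb : z = b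
      · subst hzb
        exact InSubtree.of_parent hb
      by_cases hc : p z = some b ∧ ∃ x, InSubtree p z x ∧ G.Adj a x
      · exact (InSubtree.of_parent hb).tail hc.1
      · simp only [rotateParent, if_neg hza, if_neg hzb, if_neg hc] at hz
        exact ih.tail hz
  · intro h
    induction h with
    | refl => exact InSubtree.of_parent rotateParent_fst
    | @tail y z _ hz ih =>
      by_cases hza : z = a
      · subst hza
        exact InSubtree.of_parent rotateParent_fst
      by_cases hzb : z = b
      · subst hzb
        exact InSubtree.refl _ _
      by_cases hc : p z = some b ∧ ∃ x, InSubtree p z x ∧ G.Adj a x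
      · exact (InSubtree.of_parent rotateParent_fst).tail
          (rotateParent_of_adj hza hzb hc.1 hc.2)
      · refine ih.tail ?_
        simp only [rotateParent, if_neg hza, if_neg hzb, if_neg hc]
        exact hz

end Rotate

/-! ### Lower bound: the twin as a new root. -/

section AddRoot

variable {V : Type*} {G : SimpleGraph V} {v : V}

/-- The parent function obtained by putting a new vertex above the root. -/
def addRoot {V : Type*} (p : V → Option V) : Option V → Option (Option V)
  | none => none
  | some x => some (p x)

theorem inSubtree_addRoot {p : V → Option V} {x y : V} :
    InSubtree (addRoot p) (some x) (some y) ↔ InSubtree p x y := by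
  constructor
  · intro h
    generalize hz : some y = z at h
    induction h generalizing y with
    | refl => rw [Option.some.inj hz]; exact InSubtree.refl _ _
    | @tail z' z _ hp ih =>
      subst hz
      obtain _ | z' := z'
      · rename_i h
        obtain h | ⟨c, hc, -⟩ := InSubtree.eq_or_parent h
        · cases h
        · cases hc
      · exact (ih rfl).tail (Option.some.inj hp)
  · intro h
    induction h with
    | refl => exact InSubtree.refl _ _
    | tail _ hp ih => exact ih.tail (congrArg some hp)

theorem IsElimTree.addRoot (hv : ∃ u, G.Adj v u) {p : V → Option V}
    (h : IsElimTree G p) : IsElimTree (addFalseTwin G v) (addRoot p) := by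
  obtain ⟨r, hr, hall⟩ := h.root
  have hnone : ∀ x, InSubtree (_root_.addRoot p) none x := by
    rintro (_ | x)
    · exact InSubtree.refl _ _
    · exact (InSubtree.of_parent (show _root_.addRoot p (some r) = some none from congrArg some hr)).trans
        (inSubtree_addRoot.2 (hall x))
  refine ⟨⟨none, rfl, hnone⟩, ?_, ?_⟩
  · rintro (_ | x) (_ | y) hxy
    · exact Or.inl (hnone _)
    · exact Or.inl (hnone _)
    · exact Or.inr (hnone _)
    · simpa only [inSubtree_addRoot] using h.comparable x y hxy
  · rintro (_ | x) w hw
    · cases hw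
    · have hw : p x = w := Option.some.inj hw
      obtain _ | w := w
      -- The old root is the only child of the twin, so any neighbour of `v` serves as the required
      -- neighbour of the twin below it.
      · obtain ⟨u, hu⟩ := hv
        have hxr : x = r := by
          obtain hxr | ⟨c, hc, -⟩ := (hall x).eq_or_parent
          · exact hxr.symm
          · rw [hw] at hc; cases hc
        exact ⟨some u, inSubtree_addRoot.2 (hxr ▸ hall u), hu⟩
      · obtain ⟨y, hy, hwy⟩ := h.exists_adj x w hw
        exact ⟨some y, inSubtree_addRoot.2 hy, hwy⟩

theorem addRoot_rotateParent {p : V → Option V} {a b : V} :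
    addRoot (rotateParent G p a b) =
      rotateParent (addFalseTwin G v) (addRoot p) (some a) (some b) := by
  classical
  funext x
  obtain _ | x := x
  · rw [rotateParent_of_ne (Option.some_ne_none _).symm (Option.some_ne_none _).symm
      (Option.some_ne_none _).symm]
    rfl
  · have hiff : (∃ y, InSubtree (addRoot p) (some x) y ∧ (addFalseTwin G v).Adj (some a) y) ↔
        ∃ y, InSubtree p x y ∧ G.Adj a y := by
      constructor
      · rintro ⟨_ | y, hy, hay⟩
        · obtain h | ⟨c, hc, -⟩ := hy.eq_or_parent
          · cases h
          · cases hc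
        · exact ⟨y, inSubtree_addRoot.1 hy, hay⟩
      · rintro ⟨y, hy, hay⟩
        exact ⟨some y, inSubtree_addRoot.2 hy, hay⟩
    simp only [rotateParent, hiff, addRoot, Option.some.injEq]
    split_ifs <;> rfl

end AddRoot

/-! ### Transport along automorphisms. -/

section Relabel

variable {V : Type*} {G : SimpleGraph V} (σ : G ≃g G)

/-- The parent function transported along a graph automorphism. -/
def relabelParent (p : V → Option V) : V → Option V := fun x => (p (σ.symm x)).map σ

variable {σ}

theorem relabelParent_apply {p : V → Option V} {x : V} :
    relabelParent σ p (σ x) = (p x).map σ := by simp [relabelParent]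

theorem relabelParent_eq_some {p : V → Option V} {x y : V} :
    relabelParent σ p (σ x) = some (σ y) ↔ p x = some y := by
  simp [relabelParent_apply]

theorem relabelParent_eq_none {p : V → Option V} {x : V} :
    relabelParent σ p (σ x) = none ↔ p x = none := by
  simp [relabelParent_apply]

theorem inSubtree_relabelParent {p : V → Option V} {x y : V} :
    InSubtree (relabelParent σ p) (σ x) (σ y) ↔ InSubtree p x y := by
  constructor
  · intro h
    generalize hz : σ y = z at h
    induction h generalizing y with
    | refl => rw [σ.injective hz]; exact InSubtree.refl _ _
    | @tail z' z _ hp ih =>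
      subst hz
      obtain ⟨z', rfl⟩ := σ.surjective z'
      exact (ih rfl).tail (relabelParent_eq_some.1 hp)
  · intro h
    induction h with
    | refl => exact InSubtree.refl _ _
    | tail _ hp ih => exact ih.tail (relabelParent_eq_some.2 hp)

theorem IsElimTree.relabel {p : V → Option V} (h : IsElimTree G p) :
    IsElimTree G (relabelParent σ p) := by
  obtain ⟨r, hr, hall⟩ := h.root
  refine ⟨⟨σ r, relabelParent_eq_none.2 hr, fun x => ?_⟩, fun x y hxy => ?_, fun x w hw => ?_⟩
  · obtain ⟨x, rfl⟩ := σ.surjective x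
    exact inSubtree_relabelParent.2 (hall x)
  · obtain ⟨x, rfl⟩ := σ.surjective x
    obtain ⟨y, rfl⟩ := σ.surjective y
    simp only [inSubtree_relabelParent]
    exact h.comparable x y (σ.map_adj_iff.1 hxy)
  · obtain ⟨x, rfl⟩ := σ.surjective x
    obtain ⟨w, rfl⟩ := σ.surjective w
    obtain ⟨y, hy, hwy⟩ := h.exists_adj x w (relabelParent_eq_some.1 hw)
    exact ⟨σ y, inSubtree_relabelParent.2 hy, σ.map_adj_iff.2 hwy⟩

theorem relabelParent_rotateParent {p : V → Option V} {a b : V} :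
    relabelParent σ (rotateParent G p a b) = rotateParent G (relabelParent σ p) (σ a) (σ b) := by
  classical
  funext x
  obtain ⟨x, rfl⟩ := σ.surjective x
  have hiff : (∃ y, InSubtree (relabelParent σ p) (σ x) y ∧ G.Adj (σ a) y) ↔
      ∃ y, InSubtree p x y ∧ G.Adj a y := by
    constructor
    · rintro ⟨y, hy, hay⟩
      obtain ⟨y, rfl⟩ := σ.surjective y
      exact ⟨y, inSubtree_relabelParent.1 hy, σ.map_adj_iff.1 hay⟩
    · rintro ⟨y, hy, hay⟩
      exact ⟨σ y, inSubtree_relabelParent.2 hy, σ.map_adj_iff.2 hay⟩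
  have hb : (p x).map σ = some (σ b) ↔ p x = some b := by
    rw [← relabelParent_apply, relabelParent_eq_some]
  rw [relabelParent_apply]
  simp only [rotateParent, hb, hiff, relabelParent_apply, σ.injective.eq_iff]
  split_ifs <;> rfl

end Relabel

/-! ### A pentagon in the rotation graph. -/

section Pentagon

variable {V : Type*} {G : SimpleGraph V}

/-- A path on the vertices of `U`, hanging from the root, below which a tree can be attached. -/
theorem exists_path_parent [DecidableEq V] (U : Finset V) : ∃ (q : V → Option V) (t : Option V),
    (∀ u ∈ U, ∀ y, q u = some y → y ∈ U) ∧ (∀ y, t = some y → y ∈ U) ∧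
    ∀ p : V → Option V, (∀ u ∈ U, p u = q u) → ∀ z, p z = t →
      (∃ r, p r = none ∧ InSubtree p r z ∧ ∀ u ∈ U, InSubtree p r u) ∧
      (∀ u ∈ U, InSubtree p u z) := by
  induction U using Finset.induction_on with
  | empty =>
    -- With an empty path the attaching point is `none`, so that `z` is itself the root.
    refine ⟨fun _ => none, none, by simp, by simp, fun p _ z hz => ?_⟩
    exact ⟨⟨z, hz, InSubtree.refl _ _, by simp⟩, by simp⟩
  | insert x U hx ih =>
    obtain ⟨q, t, hq, ht, h⟩ := ih
    -- The new vertex goes to the bottom: its parent is the old attaching point, and it becomes the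
    -- new one.
    refine ⟨Function.update q x t, some x, ?_, ?_, ?_⟩
    · intro u hu y hy
      by_cases hux : u = x
      · subst hux
        rw [Function.update_self] at hy
        exact Finset.mem_insert_of_mem (ht y hy)
      · rw [Function.update_of_ne hux] at hy
        exact Finset.mem_insert_of_mem (hq u (Finset.mem_of_mem_insert_of_ne hu hux) y hy)
    · rintro y hy
      rw [← Option.some.inj hy]
      exact Finset.mem_insert_self _ _
    · intro p hp z hz
      obtain ⟨⟨r, hr, hrx, hru⟩, hux⟩ := h p (fun u hu => by
        rw [hp u (Finset.mem_insert_of_mem hu),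
          Function.update_of_ne (ne_of_mem_of_not_mem hu hx)]) x (by
        rw [hp x (Finset.mem_insert_self _ _), Function.update_self])
      refine ⟨⟨r, hr, hrx.tail hz, fun u hu => ?_⟩, fun u hu => ?_⟩
      · obtain rfl | hu := Finset.mem_insert.1 hu
        · exact hrx
        · exact hru u hu
      · obtain rfl | hu := Finset.mem_insert.1 hu
        · exact InSubtree.of_parent hz
        · exact (hux u hu).tail hz

/-- If a connected graph has two nonadjacent vertices `a`, `b` with a common neighbour `w` such
that `{a, b, w}` is dominating, then its rotation graph contains a pentagon. -/
theorem three_le_of_colorable [Finite V] (hG : G.Connected) {a b w : V} (haw : G.Adj a w)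
    (hbw : G.Adj b w) (hab : a ≠ b) (hnab : ¬ G.Adj a b)
    (hdom : ∀ x, G.Adj x a ∨ G.Adj x b ∨ G.Adj x w) {k : ℕ} (hk : (rotationGraph G).Colorable k) :
    3 ≤ k := by
  classical
  have := Fintype.ofFinite V
  obtain ⟨q, t, hq, ht, h⟩ := exists_path_parent (Finset.univ \ {a, b, w} : Finset V)
  have hU : ∀ x, x ∈ (Finset.univ \ {a, b, w} : Finset V) ↔ x ≠ a ∧ x ≠ b ∧ x ≠ w := by simp
  simp only [hU] at hq ht h
  have haw' := haw.ne
  have hbw' := hbw.ne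
  let P : Option V → Option V → Option V → V → Option V := fun A B W x =>
    if x = a then A else if x = b then B else if x = w then W else q x
  have Pa : ∀ A B W, P A B W a = A := fun A B W => by simp [P]
  have Pb : ∀ A B W, P A B W b = B := fun A B W => by simp [P, hab.symm]
  have Pw : ∀ A B W, P A B W w = W := fun A B W => by simp [P, haw'.symm, hbw'.symm]
  have Pq : ∀ A B W x, x ≠ a → x ≠ b → x ≠ w → P A B W x = q x := fun A B W x h1 h2 h3 => by
    simp [P, h1, h2, h3]
  -- Here `z` is the top of the three vertices, hung from the path. The path vertices and `z` have
  -- all of `a`, `b`, `w` below them, so domination supplies their parents' neighbours; only the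
  -- part below `z` remains to be checked.
  have key : ∀ A B W z, P A B W z = t →
      (InSubtree (P A B W) z a ∧ InSubtree (P A B W) z b ∧ InSubtree (P A B W) z w) →
      (InSubtree (P A B W) a w ∨ InSubtree (P A B W) w a) →
      (InSubtree (P A B W) b w ∨ InSubtree (P A B W) w b) →
      (∀ x u, x ≠ z → x = a ∨ x = b ∨ x = w → P A B W x = some u →
        ∃ y, InSubtree (P A B W) x y ∧ G.Adj u y) → IsElimTree G (P A B W) := by
    intro A B W z hz hzabw haw2 hbw2 hex
    obtain ⟨⟨r, hr, hrz, hru⟩, hu⟩ := h (P A B W) (fun u hu => Pq _ _ _ _ hu.1 hu.2.1 hu.2.2) z hz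
    have hz3 : ∀ x, x = a ∨ x = b ∨ x = w → InSubtree (P A B W) z x := by
      rintro x (rfl | rfl | rfl)
      exacts [hzabw.1, hzabw.2.1, hzabw.2.2]
    have hcase : ∀ x, (x = a ∨ x = b ∨ x = w) ∨ (x ≠ a ∧ x ≠ b ∧ x ≠ w) := by
      intro x; tauto
    have hdom2 : ∀ x u, InSubtree (P A B W) x z → ∃ y, InSubtree (P A B W) x y ∧ G.Adj u y := by
      intro x u hx
      obtain h1 | h1 | h1 := hdom u
      · exact ⟨a, hx.trans hzabw.1, h1⟩
      · exact ⟨b, hx.trans hzabw.2.1, h1⟩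
      · exact ⟨w, hx.trans hzabw.2.2, h1⟩
    refine ⟨⟨r, hr, fun x => ?_⟩, fun x y hxy => ?_, fun x u hx => ?_⟩
    · obtain hx | hx := hcase x
      · exact hrz.trans (hz3 x hx)
      · exact hru x hx
    · obtain hx | hx := hcase x <;> obtain hy | hy := hcase y
      · obtain rfl | rfl | rfl := hx <;> obtain rfl | rfl | rfl := hy
        · exact absurd rfl hxy.ne
        · exact absurd hxy hnab
        · exact haw2
        · exact absurd hxy.symm hnab
        · exact absurd rfl hxy.ne
        · exact hbw2
        · exact haw2.symm
        · exact hbw2.symm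
        · exact absurd rfl hxy.ne
      · exact Or.inr ((hu y hy).trans (hz3 x hx))
      · exact Or.inl ((hu x hx).trans (hz3 y hy))
      · exact InSubtree.total (hu x hx) (hu y hy)
    · obtain hx' | hx' := hcase x
      · by_cases hxz : x = z
        · exact hdom2 x u (hxz ▸ InSubtree.refl _ _)
        · exact hex x u hxz hx' hx
      · exact hdom2 x u (hu x hx')
  have hP : ∀ {A B W x y}, P A B W y = some x → InSubtree (P A B W) x y :=
    fun h => InSubtree.of_parent h
  -- The five search trees on the induced path a - w - b, in the cyclic order of the pentagon, with
  -- tops w, a, a, b, b.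
  have h1 : IsElimTree G (P (some w) (some w) t) := by
    refine key _ _ _ w (Pw _ _ _) ⟨hP (Pa _ _ _), hP (Pb _ _ _), InSubtree.refl _ _⟩
      (Or.inr (hP (Pa _ _ _))) (Or.inr (hP (Pb _ _ _))) ?_
    rintro x u hxz (rfl | rfl | rfl) hx
    · rw [Pa] at hx; cases hx; exact ⟨_, InSubtree.refl _ _, haw.symm⟩
    · rw [Pb] at hx; cases hx; exact ⟨_, InSubtree.refl _ _, hbw.symm⟩
    · exact absurd rfl hxz
  have h2 : IsElimTree G (P t (some w) (some a)) := by
    refine key _ _ _ a (Pa _ _ _) ⟨InSubtree.refl _ _, (hP (Pw _ _ _)).tail (Pb _ _ _),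
      hP (Pw _ _ _)⟩ (Or.inl (hP (Pw _ _ _))) (Or.inr (hP (Pb _ _ _))) ?_
    rintro x u hxz (rfl | rfl | rfl) hx
    · exact absurd rfl hxz
    · rw [Pb] at hx; cases hx; exact ⟨_, InSubtree.refl _ _, hbw.symm⟩
    · rw [Pw] at hx; cases hx; exact ⟨_, InSubtree.refl _ _, haw⟩
  have h3 : IsElimTree G (P t (some a) (some b)) := by
    refine key _ _ _ a (Pa _ _ _) ⟨InSubtree.refl _ _, hP (Pb _ _ _),
      (hP (Pb _ _ _)).tail (Pw _ _ _)⟩ (Or.inl ((hP (Pb _ _ _)).tail (Pw _ _ _)))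
      (Or.inl (hP (Pw _ _ _))) ?_
    rintro x u hxz (rfl | rfl | rfl) hx
    · exact absurd rfl hxz
    · rw [Pb] at hx; cases hx; exact ⟨_, hP (Pw _ _ _), haw⟩
    · rw [Pw] at hx; cases hx; exact ⟨_, InSubtree.refl _ _, hbw⟩
  have h4 : IsElimTree G (P (some b) t (some a)) := by
    refine key _ _ _ b (Pb _ _ _) ⟨hP (Pa _ _ _), InSubtree.refl _ _,
      (hP (Pa _ _ _)).tail (Pw _ _ _)⟩ (Or.inl (hP (Pw _ _ _)))
      (Or.inl ((hP (Pa _ _ _)).tail (Pw _ _ _))) ?_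
    rintro x u hxz (rfl | rfl | rfl) hx
    · rw [Pa] at hx; cases hx; exact ⟨_, hP (Pw _ _ _), hbw⟩
    · exact absurd rfl hxz
    · rw [Pw] at hx; cases hx; exact ⟨_, InSubtree.refl _ _, haw⟩
  have h5 : IsElimTree G (P (some w) t (some b)) := by
    refine key _ _ _ b (Pb _ _ _) ⟨(hP (Pw _ _ _)).tail (Pa _ _ _), InSubtree.refl _ _,
      hP (Pw _ _ _)⟩ (Or.inr (hP (Pa _ _ _))) (Or.inl (hP (Pw _ _ _))) ?_
    rintro x u hxz (rfl | rfl | rfl) hx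
    · rw [Pa] at hx; cases hx; exact ⟨_, InSubtree.refl _ _, haw.symm⟩
    · exact absurd rfl hxz
    · rw [Pw] at hx; cases hx; exact ⟨_, InSubtree.refl _ _, hbw⟩
  have hrot : ∀ (A B W A' B' W' : Option V) (u v : V) (h : IsElimTree G (P A B W))
      (h' : IsElimTree G (P A' B' W')), P A B W v = some u → (v = a ∨ v = b ∨ v = w) →
      u ≠ v → (u = a ∨ u = b ∨ u = w) →
      (∀ x, x = a ∨ x = b ∨ x = w → P A' B' W' x = rotateParent G (P A B W) u v x) →
      (rotationGraph G).Adj h.toSearchTree h'.toSearchTree := by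
    intro A B W A' B' W' u v h h' hv hv' huv hu hx
    refine (rotationGraph_adj hG).2 (Or.inl ⟨u, v, hv, funext fun x => ?_⟩)
    change P A' B' W' x = rotateParent G (P A B W) u v x
    by_cases hxx : x = a ∨ x = b ∨ x = w
    · exact hx x hxx
    · have hxu : x ≠ u := by rintro rfl; exact hxx hu
      have hxv : x ≠ v := by rintro rfl; exact hxx hv'
      push Not at hxx
      have hpx : ∀ A B W, P A B W x = q x := fun A B W => Pq A B W x hxx.1 hxx.2.1 hxx.2.2
      rw [rotateParent_of_ne hxu hxv, hpx, hpx]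
      rw [hpx]
      intro hc
      have := hq x hxx v hc
      tauto
  have ht' : ∀ x, x = a ∨ x = b ∨ x = w → t ≠ some x := by
    intro x hx hc
    have := ht x hc
    tauto
  obtain ⟨C⟩ := hk
  have e12 := C.valid (hrot _ _ _ _ _ _ w a h1 h2 (Pa _ _ _) (by tauto) haw'.symm (by tauto) (by
    rintro x (rfl | rfl | rfl)
    · rw [Pa, rotateParent_snd haw'.symm, Pw]
    · rw [Pb, rotateParent_of_ne hbw' hab.symm, Pb]
      rw [Pb]; simpa using haw'.symm
    · rw [Pw, rotateParent_fst]))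
  have e23 := C.valid (hrot _ _ _ _ _ _ w b h2 h3 (Pb _ _ _) (by tauto) hbw'.symm (by tauto) (by
    rintro x (rfl | rfl | rfl)
    · rw [Pa, rotateParent_of_ne haw' hab, Pa]
      rw [Pa]; exact ht' _ (by tauto)
    · rw [Pb, rotateParent_snd hbw'.symm, Pw]
    · rw [Pw, rotateParent_fst]))
  have e34 := C.valid (hrot _ _ _ _ _ _ a b h3 h4 (Pb _ _ _) (by tauto) hab (by tauto) (by
    rintro x (rfl | rfl | rfl)
    · rw [Pa, rotateParent_fst]
    · rw [Pb, rotateParent_snd hab, Pa]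
    · rw [Pw, rotateParent_of_adj haw'.symm hbw'.symm (Pw _ _ _)
        ⟨_, InSubtree.refl _ _, haw⟩]))
  have e45 := C.valid (hrot _ _ _ _ _ _ a w h4 h5 (Pw _ _ _) (by tauto) haw' (by tauto) (by
    rintro x (rfl | rfl | rfl)
    · rw [Pa, rotateParent_fst]
    · rw [Pb, rotateParent_of_ne hab.symm hbw', Pb]
      rw [Pb]; exact ht' _ (by tauto)
    · rw [Pw, rotateParent_snd haw', Pa]))
  have e51 := C.valid (hrot _ _ _ _ _ _ b w h5 h1 (Pw _ _ _) (by tauto) hbw' (by tauto) (by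
    rintro x (rfl | rfl | rfl)
    -- The subtree of `a` is `a` alone, which is not adjacent to `b`, so it stays below `w`.
    · rw [Pa, rotateParent_of_not_adj hab haw', Pa]
      rintro ⟨y, hy, hby⟩
      obtain rfl | ⟨c, hc, -⟩ := hy.eq_or_child
      · exact hnab hby.symm
      · have : c = x ∨ c = b ∨ c = w := by
          by_contra hcc
          push Not at hcc
          rw [Pq _ _ _ _ hcc.1 hcc.2.1 hcc.2.2] at hc
          exact (hq c hcc x hc).1 rfl
        obtain rfl | rfl | rfl := this
        · rw [Pa] at hc; simp at hc; exact haw' hc.symm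
        · rw [Pb] at hc; exact ht' x (by tauto) hc
        · rw [Pw] at hc; simp at hc; exact hab hc.symm
    · rw [Pb, rotateParent_fst]
    · rw [Pw, rotateParent_snd hbw', Pb]))
  -- A 5-cycle is not 2-colourable.
  simp only [ne_eq, Fin.ext_iff] at e12 e23 e34 e45 e51
  omega

end Pentagon

/-! ### Search trees and vertices with common neighbourhood `B`. -/

/-- Every vertex outside of `B` has neighbourhood `B`. -/
def IsJoinWith {V : Type*} (G : SimpleGraph V) (B : Set V) : Prop :=
  ∀ u ∉ B, ∀ y, G.Adj u y ↔ y ∈ B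

namespace IsElimTree

variable {V : Type*} {G : SimpleGraph V} {B : Set V} {p : V → Option V} {c w x y z : V}

/-- A vertex outside of `B` that has a child is comparable to every vertex. -/
theorem comparable_of_child (h : IsElimTree G p) (hB : IsJoinWith G B) (hx : x ∉ B)
    (hc : p c = some x) (z : V) : InSubtree p x z ∨ InSubtree p z x := by
  by_cases hz : z ∈ B
  · exact h.comparable x z ((hB x hx z).2 hz)
  · obtain ⟨t, ht, hxt⟩ := h.exists_adj c x hc
    have hxt' := (InSubtree.of_parent hc).trans ht
    obtain h1 | h1 := h.comparable z t ((hB z hz t).2 ((hB x hx t).1 hxt))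
    · exact InSubtree.total hxt' h1
    · exact Or.inl (hxt'.trans h1)

/-- If `y ∉ B` is not an ancestor of `x ∉ B`, then every child of `x` is an ancestor of `y`. -/
theorem child_above (h : IsElimTree G p) (hB : IsJoinWith G B) (hx : x ∉ B) (hy : y ∉ B)
    (hyx : ¬ InSubtree p y x) (hc : p c = some x) : InSubtree p c y := by
  obtain ⟨t, ht, hxt⟩ := h.exists_adj c x hc
  obtain h1 | h1 := h.comparable y t ((hB y hy t).2 ((hB x hx t).1 hxt))
  · obtain h2 | h2 := InSubtree.total ht h1
    · exact h2
    · by_cases hyc : y = c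
      · exact hyc ▸ InSubtree.refl _ _
      · exact absurd (h2.to_parent hyc hc) hyx
  · exact ht.trans h1

/-- All children of `x` lie above `y`, hence are comparable siblings. This is what lets `x` be
spliced out of the tree. -/
theorem child_unique (h : IsElimTree G p) (hB : IsJoinWith G B) (hx : x ∉ B) (hy : y ∉ B)
    (hyx : ¬ InSubtree p y x) (hc : p c = some x) (hw : p w = some x) : c = w := by
  obtain h1 | h1 := InSubtree.total (h.child_above hB hx hy hyx hc) (h.child_above hB hx hy hyx hw)
  · exact h.eq_of_siblings hc hw h1
  · exact (h.eq_of_siblings hw hc h1).symm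

/-- If `y ∉ B` is not an ancestor of `x ∉ B`, then every proper ancestor of `x` is an ancestor
of `y`. -/
theorem above_of_above (h : IsElimTree G p) (hB : IsJoinWith G B) (hy : y ∉ B)
    (hyx : ¬ InSubtree p y x) (hw : InSubtree p w x) (hwx : w ≠ x) : InSubtree p w y := by
  obtain ⟨t, ht, htB⟩ : ∃ t, InSubtree p w t ∧ t ∈ B := by
    by_cases hwB : w ∈ B
    · exact ⟨w, InSubtree.refl _ _, hwB⟩
    · obtain h1 | ⟨c, hc, -⟩ := hw.eq_or_child
      · exact absurd h1 hwx
      · obtain ⟨t, ht, hwt⟩ := h.exists_adj c w hc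
        exact ⟨t, (InSubtree.of_parent hc).trans ht, (hB w hwB t).1 hwt⟩
  obtain h1 | h1 := h.comparable y t ((hB y hy t).2 htB)
  · obtain h2 | h2 := InSubtree.total ht h1
    · exact h2
    · exact absurd (h2.trans hw) hyx
  · exact ht.trans h1

end IsElimTree

/-! ### Deleting the upper twin. -/

section Splice

variable {V : Type*} {G : SimpleGraph V} {v : V}

open Classical in
/-- The parent function obtained by deleting the vertex `none`, whose children are attached to its
parent. -/
noncomputable def splice (p : Option V → Option (Option V)) : V → Option V := fun x =>
  if p (some x) = some none then (p none).join else (p (some x)).join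

variable {p : Option V → Option (Option V)} {x y : V}

theorem splice_eq_some : splice p x = some y ↔
    p (some x) = some (some y) ∨ p (some x) = some none ∧ p none = some (some y) := by
  unfold splice
  split_ifs with h
  · simp [h, Option.join_eq_some_iff]
  · simp [h, Option.join_eq_some_iff]

theorem splice_of_some (h : p (some x) = some (some y)) : splice p x = some y :=
  splice_eq_some.2 (Or.inl h)

theorem splice_of_none (h : p (some x) = some none) : splice p x = (p none).join := by
  simp [splice, h]

theorem splice_of_ne (h : p (some x) ≠ some none) : splice p x = (p (some x)).join := by
  simp [splice, h]

theorem inSubtree_splice : InSubtree (splice p) x y ↔ InSubtree p (some x) (some y) := by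
  constructor
  · intro h
    induction h with
    | refl => exact InSubtree.refl _ _
    | tail _ hp ih =>
      obtain hp | ⟨h1, h2⟩ := splice_eq_some.1 hp
      · exact ih.tail hp
      · exact (ih.tail h2).tail h1
  · suffices H : ∀ z, InSubtree p (some x) z → ∀ y, z = some y ∨ (z = none ∧ p (some y) = some none) →
        InSubtree (splice p) x y from fun h => H _ h y (Or.inl rfl)
    intro z h
    induction h with
    | refl =>
      rintro y (h | ⟨h, -⟩)
      · rw [Option.some.inj h]; exact InSubtree.refl _ _
      · cases h
    | @tail z' z _ hp ih =>
      rintro y (rfl | ⟨rfl, hy⟩)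
      · obtain _ | z' := z'
        · exact ih y (Or.inr ⟨rfl, hp⟩)
        · exact (ih z' (Or.inl rfl)).tail (splice_of_some hp)
      · obtain _ | z' := z'
        · exact ih y (Or.inr ⟨rfl, hy⟩)
        · exact (ih z' (Or.inl rfl)).tail (splice_eq_some.2 (Or.inr ⟨hy, hp⟩))

variable {B : Set (Option V)}

theorem IsElimTree.splice (h : IsElimTree (addFalseTwin G v) p)
    (hB : IsJoinWith (addFalseTwin G v) B) (hn : none ∉ B) (hv : some v ∉ B)
    (hnv : ¬ InSubtree p (some v) none) : IsElimTree G (splice p) := by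
  obtain ⟨r, hr, hall⟩ := h.root
  -- A neighbour that gets deleted is replaced by its twin `v`, which lies below every proper
  -- ancestor of `none`.
  have hexists : ∀ {a x : V} {y : Option V}, InSubtree p (some x) y →
      (addFalseTwin G v).Adj (some a) y → ∃ z, InSubtree p (some x) (some z) ∧ G.Adj a z := by
    rintro a x (_ | z) hy hay
    · refine ⟨v, h.above_of_above hB hv hnv hy (Option.some_ne_none _), ?_⟩
      exact G.adj_symm hay
    · exact ⟨z, hy, hay⟩
  refine ⟨?_, fun x y hxy => ?_, fun x a hx => ?_⟩
  · obtain _ | r := r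
    -- If `none` is the root, its unique child becomes the root.
    · obtain h1 | ⟨_ | ρ, hρ, -⟩ := (hall (some v)).eq_or_child
      · cases h1
      · exact absurd rfl (h.parent_ne hρ)
      · refine ⟨ρ, by rw [splice_of_none hρ, hr]; rfl, fun x => inSubtree_splice.2 ?_⟩
        obtain h1 | ⟨c, hc, hcx⟩ := (hall (some x)).eq_or_child
        · cases h1
        · rwa [h.child_unique hB hn hv hnv hρ hc]
    · refine ⟨r, ?_, fun x => inSubtree_splice.2 (hall _)⟩
      rw [splice_of_ne (by rw [hr]; simp), hr]
      rfl
  · simp only [inSubtree_splice]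
    exact h.comparable (some x) (some y) hxy
  · simp only [inSubtree_splice]
    obtain hx | ⟨hx, ha⟩ := splice_eq_some.1 hx
    · obtain ⟨y, hy, hay⟩ := h.exists_adj _ _ hx
      exact hexists hy hay
    · obtain ⟨y, hy, hay⟩ := h.exists_adj _ _ ha
      obtain ⟨z, hz, haz⟩ : ∃ z, InSubtree p none (some z) ∧ G.Adj a z := by
        obtain _ | z := y
        · refine ⟨v, ?_, G.adj_symm hay⟩
          exact (InSubtree.of_parent hx).trans (h.child_above hB hn hv hnv hx)
        · exact ⟨z, hy, hay⟩
      obtain h1 | ⟨c, hc, hcz⟩ := hz.eq_or_child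
      · cases h1
      · rw [h.child_unique hB hn hv hnv hc hx] at hcz
        exact ⟨z, hcz, haz⟩

/-- A rotation that involves the deleted vertex is not seen after the deletion. -/
theorem splice_rotateParent_of_mem {a b : Option V} (h : IsElimTree (addFalseTwin G v) p)
    (h' : IsElimTree (addFalseTwin G v) (rotateParent (addFalseTwin G v) p a b))
    (hB : IsJoinWith (addFalseTwin G v) B) (hn : none ∉ B) (hv : some v ∉ B)
    (hnv : ¬ InSubtree p (some v) none)
    (hnv' : ¬ InSubtree (rotateParent (addFalseTwin G v) p a b) (some v) none)
    (hb : p b = some a) (hab : a = none ∨ b = none) :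
    splice (rotateParent (addFalseTwin G v) p a b) = splice p := by
  have hne := h.parent_ne hb
  have hpa : p a ≠ some b := fun hc => h.not_parent hc (InSubtree.of_parent hb)
  obtain rfl | rfl := hab
  · obtain ⟨b, rfl⟩ := Option.ne_none_iff_exists'.1 hne.symm
    funext x
    by_cases hxb : x = b
    · subst hxb
      rw [splice_of_none hb, splice_of_ne, rotateParent_snd hne]
      rw [rotateParent_snd hne]
      exact fun hc => absurd rfl (h.parent_ne hc)
    · have hxb' : some x ≠ some b := fun hc => hxb (Option.some.inj hc)
      have hxn : p (some x) ≠ some none := fun hc =>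
        hxb' (h.child_unique hB hn hv hnv hc hb)
      by_cases hc : p (some x) = some (some b)
      · rw [splice_of_some hc]
        -- Whether `x` moves below `none` or stays below `b`, its parent after the deletion is `b`.
        by_cases he : ∃ y, InSubtree p (some x) y ∧ (addFalseTwin G v).Adj none y
        · rw [splice_of_none (rotateParent_of_adj (Option.some_ne_none _) hxb' hc he),
            rotateParent_fst]
          rfl
        · exact splice_of_some ((rotateParent_of_not_adj (Option.some_ne_none _) hxb' he).trans hc)
      · have := rotateParent_of_ne (G := addFalseTwin G v) (Option.some_ne_none x) hxb' hc
        rw [splice_of_ne hxn, splice_of_ne (this ▸ hxn), this]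
  · obtain ⟨a, rfl⟩ := Option.ne_none_iff_exists'.1 hne
    funext x
    by_cases hxa : x = a
    · subst hxa
      rw [splice_of_none rotateParent_fst, rotateParent_snd hne, splice_of_ne hpa]
    · have hxa' : some x ≠ some a := fun hc => hxa (Option.some.inj hc)
      have hxn : rotateParent (addFalseTwin G v) p (some a) none (some x) ≠ some none := fun hc =>
        hxa' (h'.child_unique hB hn hv hnv' hc rotateParent_fst)
      rw [splice_of_ne hxn]
      by_cases hc : p (some x) = some none
      · rw [splice_of_none hc, hb]
        by_cases he : ∃ y, InSubtree p (some x) y ∧ (addFalseTwin G v).Adj (some a) y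
        · rw [rotateParent_of_adj hxa' (Option.some_ne_none _) hc he]
        · exact absurd ((rotateParent_of_not_adj hxa' (Option.some_ne_none _) he).trans hc) hxn
      · rw [splice_of_ne hc, rotateParent_of_ne hxa' (Option.some_ne_none _) hc]

/-- A rotation that does not involve the deleted vertex remains a rotation. -/
theorem splice_rotateParent {a b : V} (h : IsElimTree (addFalseTwin G v) p)
    (hB : IsJoinWith (addFalseTwin G v) B) (hn : none ∉ B) (hv : some v ∉ B)
    (hnv : ¬ InSubtree p (some v) none) (hb : p (some b) = some (some a)) :
    splice (rotateParent (addFalseTwin G v) p (some a) (some b)) =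
      rotateParent G (splice p) a b := by
  have hne := h.parent_ne hb
  have hne' : a ≠ b := fun hc => hne (congrArg some hc)
  have hpa : p (some a) ≠ some (some b) := fun hc => h.not_parent hc (InSubtree.of_parent hb)
  have hexists : ∀ {x : V}, (∃ y, InSubtree p (some x) y ∧ (addFalseTwin G v).Adj (some a) y) ↔
      ∃ z, InSubtree (splice p) x z ∧ G.Adj a z := by
    intro x
    simp only [inSubtree_splice]
    constructor
    · rintro ⟨_ | z, hy, hay⟩
      · refine ⟨v, h.above_of_above hB hv hnv hy (Option.some_ne_none _), ?_⟩
        exact G.adj_symm hay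
      · exact ⟨z, hy, hay⟩
    · rintro ⟨z, hz, haz⟩
      exact ⟨some z, hz, haz⟩
  have hna : (none : Option V) ≠ some a := (Option.some_ne_none _).symm
  have hnb : (none : Option V) ≠ some b := (Option.some_ne_none _).symm
  funext x
  by_cases hxa : x = a
  · subst hxa
    rw [splice_of_some rotateParent_fst, rotateParent_fst]
  by_cases hxb : x = b
  · subst hxb
    rw [rotateParent_snd hne']
    by_cases hc : p (some a) = some none
    · have hc' : p none ≠ some (some x) := fun hd =>
        h.not_parent hd ((InSubtree.of_parent hc).trans (InSubtree.of_parent hb))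
      rw [splice_of_none hc, splice_of_none ((rotateParent_snd hne).trans hc),
        rotateParent_of_ne hna hnb hc']
    · rw [splice_of_ne hc, splice_of_ne, rotateParent_snd hne]
      rwa [rotateParent_snd hne]
  have hxa' : some x ≠ some a := fun hc => hxa (Option.some.inj hc)
  have hxb' : some x ≠ some b := fun hc => hxb (Option.some.inj hc)
  by_cases hc : p (some x) = some none
  · have hx' : rotateParent (addFalseTwin G v) p (some a) (some b) (some x) = some none := by
      rw [rotateParent_of_ne hxa' hxb' (by rw [hc]; simp), hc]
    rw [splice_of_none hx']
    by_cases hd : p none = some (some b)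
    · have hx : splice p x = some b := splice_eq_some.2 (Or.inr ⟨hc, hd⟩)
      have hvx := h.child_above hB hn hv hnv hc
      -- Upstairs it is `none` that moves or stays, downstairs its unique child `x`. The two
      -- criteria agree because `v` lies below `x` and has the same neighbours as `none`.
      have hiff : (∃ y, InSubtree p none y ∧ (addFalseTwin G v).Adj (some a) y) ↔
          ∃ y, InSubtree p (some x) y ∧ (addFalseTwin G v).Adj (some a) y := by
        constructor
        · rintro ⟨y, hy, hay⟩
          obtain rfl | ⟨c, hcn, hcy⟩ := hy.eq_or_child
          · exact ⟨some v, hvx, G.adj_symm hay⟩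
          · rw [h.child_unique hB hn hv hnv hcn hc] at hcy
            exact ⟨y, hcy, hay⟩
        · rintro ⟨y, hy, hay⟩
          exact ⟨y, (InSubtree.of_parent hc).trans hy, hay⟩
      by_cases he : ∃ z, InSubtree (splice p) x z ∧ G.Adj a z
      · rw [rotateParent_of_adj hxa hxb hx he,
          rotateParent_of_adj hna hnb hd (hiff.2 (hexists.2 he))]
        rfl
      · rw [rotateParent_of_not_adj hxa hxb he, hx,
          rotateParent_of_not_adj hna hnb (fun hf => he (hexists.1 (hiff.1 hf))), hd]
        rfl
    · have hx : splice p x ≠ some b := by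
        intro hx
        obtain hx | hx := splice_eq_some.1 hx
        · rw [hc] at hx; simp at hx
        · exact hd hx.2
      rw [rotateParent_of_ne hxa hxb hx, rotateParent_of_ne hna hnb hd, splice_of_none hc]
  · by_cases hd : p (some x) = some (some b)
    · have hx := splice_of_some hd
      by_cases he : ∃ z, InSubtree (splice p) x z ∧ G.Adj a z
      · rw [rotateParent_of_adj hxa hxb hx he,
          splice_of_some (rotateParent_of_adj hxa' hxb' hd (hexists.2 he))]
      · rw [rotateParent_of_not_adj hxa hxb he, hx,
          splice_of_some ((rotateParent_of_not_adj hxa' hxb' (fun hf => he (hexists.1 hf))).trans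
            hd)]
    · have hx : splice p x ≠ some b := by
        intro hx
        obtain hx | hx := splice_eq_some.1 hx
        · exact hd hx
        · exact hc hx.1
      have hx' := rotateParent_of_ne (G := addFalseTwin G v) hxa' hxb' hd
      rw [rotateParent_of_ne hxa hxb hx, splice_of_ne hc, splice_of_ne (hx' ▸ hc), hx']

end Splice

/-! ### Depth under rotation. -/

section Depth

variable {V : Type*} {G : SimpleGraph V} {p : V → Option V} {a b x : V}

/-- The number of ancestors of a vertex, itself included. -/
noncomputable def depth {V : Type*} (p : V → Option V) (x : V) : ℕ := {y | InSubtree p y x}.ncard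

theorem depth_relabelParent {σ : G ≃g G} : depth (relabelParent σ p) (σ x) = depth p x := by
  have : {y | InSubtree (relabelParent σ p) y (σ x)} = σ '' {y | InSubtree p y x} := by
    ext y
    obtain ⟨y, rfl⟩ := σ.surjective y
    simp only [Set.mem_ofPred_eq, inSubtree_relabelParent, σ.injective.mem_set_image]
  rw [depth, this, Set.ncard_image_of_injective _ σ.injective, depth]

theorem depth_rotateParent_fst [Finite V] (h : IsElimTree G p) (hb : p b = some a) :
    depth (rotateParent G p a b) a = depth p a + 1 := by
  have hne := h.parent_ne hb
  have : {y | InSubtree (rotateParent G p a b) y a} = insert b {y | InSubtree p y a} := by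
    ext y
    simp only [Set.mem_ofPred_eq, Set.mem_insert_iff]
    by_cases hyb : y = b
    · subst hyb
      exact iff_of_true (InSubtree.of_parent rotateParent_fst) (Or.inl rfl)
    by_cases hya : y = a
    · subst hya
      exact iff_of_true (InSubtree.refl _ _) (Or.inr (InSubtree.refl _ _))
    · rw [inSubtree_rotateParent_of_ne hne hb hya hyb]
      simp [hyb]
  have hnot : b ∉ {y | InSubtree p y a} := h.not_parent hb
  rw [depth, this, Set.ncard_insert_of_notMem hnot (Set.toFinite _), depth]

theorem depth_rotateParent_snd [Finite V] (h : IsElimTree G p) (h' : IsElimTree G (rotateParent G p a b))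
    (hb : p b = some a) : depth p b = depth (rotateParent G p a b) b + 1 := by
  have hne := h.parent_ne hb
  have : {y | InSubtree p y b} = insert a {y | InSubtree (rotateParent G p a b) y b} := by
    ext y
    simp only [Set.mem_ofPred_eq, Set.mem_insert_iff]
    by_cases hya : y = a
    · subst hya
      exact iff_of_true (InSubtree.of_parent hb) (Or.inl rfl)
    by_cases hyb : y = b
    · subst hyb
      exact iff_of_true (InSubtree.refl _ _) (Or.inr (InSubtree.refl _ _))
    · rw [inSubtree_rotateParent_of_ne hne hb hya hyb]
      simp [hya]
  have hnot : a ∉ {y | InSubtree (rotateParent G p a b) y b} := h'.not_parent rotateParent_fst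
  rw [depth, this, Set.ncard_insert_of_notMem hnot (Set.toFinite _), depth]

/-- Having a child before and after makes `x` comparable to everything in both trees, so `a` and `b`
are both above `x` or both not. A leaf hanging from `a` or `b` could change its depth. -/
theorem depth_rotateParent_of_ne {B : Set V} (hB : IsJoinWith G B) (hx : x ∉ B)
    (h : IsElimTree G p) (h' : IsElimTree G (rotateParent G p a b)) (hb : p b = some a)
    (hxa : x ≠ a) (hxb : x ≠ b) (hc : ∃ c, p c = some x)
    (hc' : ∃ c, rotateParent G p a b c = some x) :
    depth (rotateParent G p a b) x = depth p x := by
  have hne := h.parent_ne hb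
  obtain ⟨c, hc⟩ := hc
  obtain ⟨c', hc'⟩ := hc'
  have : {y | InSubtree (rotateParent G p a b) y x} = {y | InSubtree p y x} := by
    ext y
    simp only [Set.mem_ofPred_eq]
    by_cases hyb : y = b
    · subst hyb
      rw [inSubtree_rotateParent_snd hne hb]
      refine ⟨fun hax => ?_, fun hbx => (InSubtree.of_parent hb).trans hbx⟩
      obtain h1 | h1 := h.comparable_of_child hB hx hc y
      · exact absurd (h.antisymm hax (h1.to_parent hxb hb)).symm hxa
      · exact h1
    by_cases hya : y = a
    · subst hya
      constructor
      · intro hax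
        rw [← inSubtree_rotateParent_snd (G := G) hne hb]
        exact (InSubtree.of_parent rotateParent_fst).trans hax
      · intro hax
        obtain h1 | h1 := h'.comparable_of_child hB hx hc' y
        · rw [inSubtree_rotateParent_of_ne hne hb hxa hxb] at h1
          exact absurd (h.antisymm h1 hax) hxa
        · exact h1
    · exact inSubtree_rotateParent_of_ne hne hb hya hyb
  rw [depth, this, depth]

end Depth

/-! ### The two twins and the colouring. -/

section Twin

variable {V : Type*} {G : SimpleGraph V} {v : V}

theorem addFalseTwin_adj {x y : Option V} :
    (addFalseTwin G v).Adj x y ↔ G.Adj (x.getD v) (y.getD v) := by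
  obtain _ | x := x <;> obtain _ | y := y
  · exact iff_of_false (fun h => h) (G.loopless.irrefl v)
  · exact Iff.rfl
  · exact G.adj_comm v x
  · exact Iff.rfl

theorem addFalseTwin_connected (hG : G.Connected) (hv : ∃ u, G.Adj v u) :
    (addFalseTwin G v).Connected := by
  have h1 : ∀ x : V, (addFalseTwin G v).Reachable (some v) (some x) := fun x =>
    (hG.preconnected v x).map (⟨some, fun {a b} hab => hab⟩ : G →g addFalseTwin G v)
  have h2 : ∀ x, (addFalseTwin G v).Reachable (some v) x := by
    rintro (_ | x)
    · obtain ⟨u, hu⟩ := hv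
      have : (addFalseTwin G v).Adj (some u) none := hu
      exact (h1 u).trans this.reachable
    · exact h1 x
  exact ⟨fun x y => (h2 x).symm.trans (h2 y)⟩

open Classical in
/-- The automorphism that exchanges `v` and its twin. -/
noncomputable def twinSwap (G : SimpleGraph V) (v : V) : addFalseTwin G v ≃g addFalseTwin G v where
  toEquiv := Equiv.swap none (some v)
  map_rel_iff' := by
    have h : ∀ x : Option V, (Equiv.swap none (some v) x).getD v = x.getD v := by
      intro x
      rw [Equiv.swap_apply_def]
      split_ifs with h1 h2
      · rw [h1]; rfl
      · rw [h2]; rfl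
      · rfl
    intro a b
    rw [addFalseTwin_adj, addFalseTwin_adj, h, h]

theorem twinSwap_none : twinSwap G v none = some v := by
  classical exact Equiv.swap_apply_left none (some v)

theorem twinSwap_some : twinSwap G v (some v) = none := by
  classical exact Equiv.swap_apply_right none (some v)

theorem twinSwap_of_ne {x : Option V} (h1 : x ≠ none) (h2 : x ≠ some v) : twinSwap G v x = x := by
  classical exact Equiv.swap_apply_of_ne_of_ne h1 h2

theorem twinSwap_twinSwap (x : Option V) : twinSwap G v (twinSwap G v x) = x := by
  classical exact Equiv.swap_apply_self _ _ x

variable {p : Option V → Option (Option V)}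

theorem relabelParent_twinSwap_twinSwap :
    relabelParent (twinSwap G v) (relabelParent (twinSwap G v) p) = p := by
  funext x
  rw [← twinSwap_twinSwap (G := G) (v := v) x, relabelParent_apply, relabelParent_apply,
    Option.map_map, twinSwap_twinSwap]
  obtain h | ⟨y, h⟩ := Option.eq_none_or_eq_some (p x)
  · rw [h]; rfl
  · rw [h, Option.map_some, Function.comp_apply, twinSwap_twinSwap]

theorem inSubtree_twinSwap_some_none :
    InSubtree (relabelParent (twinSwap G v) p) (some v) none ↔ InSubtree p none (some v) := by
  rw [← inSubtree_relabelParent (σ := twinSwap G v) (p := p), twinSwap_none, twinSwap_some]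

theorem inSubtree_twinSwap_none_some :
    InSubtree (relabelParent (twinSwap G v) p) none (some v) ↔ InSubtree p (some v) none := by
  rw [← inSubtree_relabelParent (σ := twinSwap G v) (p := p), twinSwap_none, twinSwap_some]

open Classical in
/-- The parent function on `V` obtained by deleting a twin that is not a descendant of the other
one, the other one being called `v`. -/
noncomputable def twinSplice (G : SimpleGraph V) (v : V) (p : Option V → Option (Option V)) :
    V → Option V :=
  if InSubtree p (some v) none then splice (relabelParent (twinSwap G v) p) else splice p

open Classical in
/-- The shift applied to the colour of `twinSplice G v p`: the parity of the depth of the upper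
twin, shifted if the upper twin is `v`, and `2` if the twins are incomparable. -/
noncomputable def twinIndex (v : V) (p : Option V → Option (Option V)) : ℕ :=
  if InSubtree p (some v) none then (depth p (some v) + 1) % 2
  else if InSubtree p none (some v) then depth p none % 2 else 2

/-- The trees `p` and `p'` have the same image under `twinSplice` and different shifts, or images
that differ by a rotation and the same shift. -/
def TwinRel (G : SimpleGraph V) (v : V) (p p' : Option V → Option (Option V)) : Prop :=
  (twinSplice G v p' = twinSplice G v p ∧ twinIndex v p' ≠ twinIndex v p) ∨
  ((∃ a b, twinSplice G v p b = some a ∧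
    twinSplice G v p' = rotateParent G (twinSplice G v p) a b) ∧ twinIndex v p' = twinIndex v p)

variable {B : Set (Option V)}

theorem exists_child_of_inSubtree {p : V → Option V} {x y : V} (h : InSubtree p x y) (hne : x ≠ y) :
    ∃ c, p c = some x := by
  obtain h1 | ⟨c, hc, -⟩ := h.eq_or_child
  · exact absurd h1 hne
  · exact ⟨c, hc⟩

/-- Incomparable twins are leaves, and the parent of each is above the other, so they have the same
parent. -/
theorem relabelParent_twinSwap_of_incomparable (h : IsElimTree (addFalseTwin G v) p)
    (hB : IsJoinWith (addFalseTwin G v) B) (hn : none ∉ B) (hv : some v ∉ B)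
    (hvn : ¬ InSubtree p (some v) none) (hnv : ¬ InSubtree p none (some v)) :
    relabelParent (twinSwap G v) p = p := by
  obtain ⟨r, hr, hall⟩ := h.root
  have hleafn : ∀ c, p c ≠ some none := fun c hc =>
    hnv ((InSubtree.of_parent hc).trans (h.child_above hB hn hv hvn hc))
  have hleafv : ∀ c, p c ≠ some (some v) := fun c hc =>
    hvn ((InSubtree.of_parent hc).trans (h.child_above hB hv hn hnv hc))
  obtain h1 | ⟨w, hw, -⟩ := (hall none).eq_or_parent
  · exact absurd (h1 ▸ hall (some v)) hnv
  obtain h1 | ⟨u, hu, -⟩ := (hall (some v)).eq_or_parent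
  · exact absurd (h1 ▸ hall none) hvn
  have hwv := (h.above_of_above hB hv hvn (InSubtree.of_parent hw) (h.parent_ne hw)).to_parent
    (fun hc => hleafv none (hc ▸ hw)) hu
  have hun := (h.above_of_above hB hn hnv (InSubtree.of_parent hu) (h.parent_ne hu)).to_parent
    (fun hc => hleafn (some v) (hc ▸ hu)) hw
  obtain rfl := h.antisymm hwv hun
  have hfix : ∀ x, (p x).map (twinSwap G v) = p x := by
    intro x
    obtain h1 | ⟨y, h1⟩ := Option.eq_none_or_eq_some (p x)
    · rw [h1]; rfl
    · rw [h1, Option.map_some, twinSwap_of_ne]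
      · rintro rfl; exact hleafn x h1
      · rintro rfl; exact hleafv x h1
  funext x
  rw [← twinSwap_twinSwap (G := G) (v := v) x, relabelParent_apply, hfix, twinSwap_twinSwap]
  by_cases hxn : x = none
  · rw [hxn, twinSwap_none, hu, hw]
  by_cases hxv : x = some v
  · rw [hxv, twinSwap_some, hu, hw]
  · rw [twinSwap_of_ne hxn hxv]

theorem twinSplice_relabelParent (h : IsElimTree (addFalseTwin G v) p)
    (hB : IsJoinWith (addFalseTwin G v) B) (hn : none ∉ B) (hv : some v ∉ B) :
    twinSplice G v (relabelParent (twinSwap G v) p) = twinSplice G v p := by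
  unfold twinSplice
  rw [inSubtree_twinSwap_some_none, relabelParent_twinSwap_twinSwap]
  split_ifs with h1 h2 h2
  · cases h.antisymm h1 h2
  · rfl
  · rfl
  · rw [relabelParent_twinSwap_of_incomparable h hB hn hv h2 h1]

/-- The swap exchanges the depths of the twins, and the extra 1 in the index when `v` is on top
makes 0 and 1 trade places. -/
theorem twinIndex_relabelParent [Finite V] (h : IsElimTree (addFalseTwin G v) p) :
    twinIndex v (relabelParent (twinSwap G v) p) = 2 ∧ twinIndex v p = 2 ∨
      twinIndex v (relabelParent (twinSwap G v) p) + twinIndex v p = 1 := by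
  have h1 : depth (relabelParent (twinSwap G v) p) (some v) = depth p none := by
    rw [← depth_relabelParent (σ := twinSwap G v) (p := p), twinSwap_none]
  have h2 : depth (relabelParent (twinSwap G v) p) none = depth p (some v) := by
    rw [← depth_relabelParent (σ := twinSwap G v) (p := p) (x := some v), twinSwap_some]
  unfold twinIndex
  rw [inSubtree_twinSwap_some_none, inSubtree_twinSwap_none_some, h1, h2]
  split_ifs with h3 h4
  · cases h.antisymm h3 h4
  all_goals omega

theorem TwinRel.of_relabelParent [Finite V] {p' : Option V → Option (Option V)}
    (h : IsElimTree (addFalseTwin G v) p) (h' : IsElimTree (addFalseTwin G v) p')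
    (hB : IsJoinWith (addFalseTwin G v) B) (hn : none ∉ B) (hv : some v ∉ B)
    (hrel : TwinRel G v (relabelParent (twinSwap G v) p) (relabelParent (twinSwap G v) p')) :
    TwinRel G v p p' := by
  have h1 := twinIndex_relabelParent h
  have h2 := twinIndex_relabelParent h'
  unfold TwinRel at hrel ⊢
  rw [twinSplice_relabelParent h hB hn hv, twinSplice_relabelParent h' hB hn hv] at hrel
  obtain ⟨h3, h4⟩ | ⟨h3, h4⟩ := hrel
  · exact Or.inl ⟨h3, by omega⟩
  · exact Or.inr ⟨h3, by omega⟩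

/-- A rotation that exchanges the order of the twins is the exchange of the twins. -/
theorem rotateParent_eq_relabelParent {a b : Option V} (h : IsElimTree (addFalseTwin G v) p)
    (hB : IsJoinWith (addFalseTwin G v) B) (hn : none ∉ B) (hv : some v ∉ B) (hb : p b = some a)
    (hnv : InSubtree p none (some v))
    (hvn : InSubtree (rotateParent (addFalseTwin G v) p a b) (some v) none) :
    rotateParent (addFalseTwin G v) p a b = relabelParent (twinSwap G v) p := by
  have hne := h.parent_ne hb
  have hnot : ¬ InSubtree p (some v) none := fun hc => by cases h.antisymm hnv hc
  have hva : some v ≠ a := by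
    rintro rfl
    apply hnot
    rw [← inSubtree_rotateParent_snd (G := addFalseTwin G v) hne hb]
    exact (InSubtree.of_parent rotateParent_fst).trans hvn
  obtain rfl : some v = b := by
    by_contra hvb
    rw [inSubtree_rotateParent_of_ne hne hb hva hvb] at hvn
    exact hnot hvn
  rw [inSubtree_rotateParent_snd hne hb] at hvn
  -- The rotation lifts `v` above `none` only if its parent `a` is above `none`; as `none` is
  -- properly above `v`, it is above `a` too.
  obtain rfl := h.antisymm hvn (hnv.to_parent (Option.some_ne_none v).symm hb)
  funext x
  rw [← twinSwap_twinSwap (G := G) (v := v) x, relabelParent_apply, twinSwap_twinSwap]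
  by_cases hxn : x = none
  · rw [hxn, rotateParent_fst, twinSwap_none, hb, Option.map_some, twinSwap_none]
  by_cases hxv : x = some v
  · subst hxv
    rw [rotateParent_snd hne, twinSwap_some]
    obtain h1 | ⟨y, h1⟩ := Option.eq_none_or_eq_some (p none)
    · rw [h1]; rfl
    · rw [h1, Option.map_some, twinSwap_of_ne]
      · exact h.parent_ne h1
      · rintro rfl
        exact hnot (InSubtree.of_parent h1)
  rw [twinSwap_of_ne hxn hxv]
  by_cases hc : p x = some (some v)
  -- Each subtree of `v` contains a neighbour of `v`, hence of `none`, so all of them change sides.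
  · obtain ⟨y, hy, hvy⟩ := h.exists_adj _ _ hc
    rw [rotateParent_of_adj hxn hxv hc ⟨y, hy, by rwa [addFalseTwin_adj] at hvy ⊢⟩, hc,
      Option.map_some, twinSwap_some]
  · rw [rotateParent_of_ne hxn hxv hc]
    obtain h1 | ⟨y, h1⟩ := Option.eq_none_or_eq_some (p x)
    · rw [h1]; rfl
    · rw [h1, Option.map_some, twinSwap_of_ne]
      · rintro rfl
        exact hxv (h.child_unique hB hn hv hnot h1 hb)
      · rintro rfl
        exact hc h1

/-- A rotation involving `none` shifts its depth by one, or makes the twins change between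
comparable and incomparable (index 2). Any other rotation preserves both comparability and, if
`none` is above `v`, its depth. -/
theorem TwinRel.of_not_above [Finite V] {a b : Option V} (h : IsElimTree (addFalseTwin G v) p)
    (h' : IsElimTree (addFalseTwin G v) (rotateParent (addFalseTwin G v) p a b))
    (hB : IsJoinWith (addFalseTwin G v) B) (hn : none ∉ B) (hv : some v ∉ B) (hb : p b = some a)
    (hvn : ¬ InSubtree p (some v) none)
    (hvn' : ¬ InSubtree (rotateParent (addFalseTwin G v) p a b) (some v) none) :
    TwinRel G v p (rotateParent (addFalseTwin G v) p a b) := by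
  have hne := h.parent_ne hb
  have hnv : (none : Option V) ≠ some v := (Option.some_ne_none v).symm
  unfold TwinRel twinSplice twinIndex
  simp only [if_neg hvn, if_neg hvn']
  by_cases hab : a = none ∨ b = none
  · refine Or.inl ⟨splice_rotateParent_of_mem h h' hB hn hv hvn hvn' hb hab, ?_⟩
    obtain rfl | rfl := hab
    · rw [if_pos ((InSubtree.of_parent hb).trans (h.child_above hB hn hv hvn hb)),
        depth_rotateParent_fst h hb]
      split_ifs <;> omega
    · have hd := depth_rotateParent_snd h h' hb
      rw [if_pos ((InSubtree.of_parent rotateParent_fst).trans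
        (h'.child_above hB hn hv hvn' rotateParent_fst))]
      split_ifs <;> omega
  · push Not at hab
    obtain ⟨a, rfl⟩ := Option.ne_none_iff_exists'.1 hab.1
    obtain ⟨b, rfl⟩ := Option.ne_none_iff_exists'.1 hab.2
    refine Or.inr ⟨⟨a, b, splice_of_some hb, splice_rotateParent h hB hn hv hvn hb⟩, ?_⟩
    rw [inSubtree_rotateParent_of_ne hne hb hab.1.symm hab.2.symm]
    split_ifs with hc
    · rw [depth_rotateParent_of_ne hB hn h h' hb hab.1.symm hab.2.symm
        (exists_child_of_inSubtree hc hnv)]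
      rw [← inSubtree_rotateParent_of_ne (G := addFalseTwin G v) hne hb hab.1.symm hab.2.symm] at hc
      exact exists_child_of_inSubtree hc hnv
    · rfl

theorem TwinRel.of_above [Finite V] (h : IsElimTree (addFalseTwin G v) p)
    (hB : IsJoinWith (addFalseTwin G v) B) (hn : none ∉ B) (hv : some v ∉ B)
    (hnv : InSubtree p none (some v)) : TwinRel G v p (relabelParent (twinSwap G v) p) := by
  refine Or.inl ⟨twinSplice_relabelParent h hB hn hv, ?_⟩
  have h1 := twinIndex_relabelParent h
  have h2 : twinIndex v p ≠ 2 := by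
    have : ¬ InSubtree p (some v) none := fun hc => by cases h.antisymm hnv hc
    rw [twinIndex, if_neg this, if_pos hnv]
    omega
  omega

theorem twinRel_rotateParent [Finite V] {a b : Option V} (h : IsElimTree (addFalseTwin G v) p)
    (h' : IsElimTree (addFalseTwin G v) (rotateParent (addFalseTwin G v) p a b))
    (hB : IsJoinWith (addFalseTwin G v) B) (hn : none ∉ B) (hv : some v ∉ B) (hb : p b = some a) :
    TwinRel G v p (rotateParent (addFalseTwin G v) p a b) := by
  have main : ∀ {p : Option V → Option (Option V)} {a b : Option V},
      IsElimTree (addFalseTwin G v) p →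
      IsElimTree (addFalseTwin G v) (rotateParent (addFalseTwin G v) p a b) →
      p b = some a → ¬ InSubtree p (some v) none →
      TwinRel G v p (rotateParent (addFalseTwin G v) p a b) := by
    intro p a b h h' hb hvn
    by_cases hvn' : InSubtree (rotateParent (addFalseTwin G v) p a b) (some v) none
    · by_cases hnv : InSubtree p none (some v)
      · rw [rotateParent_eq_relabelParent h hB hn hv hb hnv hvn']
        exact TwinRel.of_above h hB hn hv hnv
      -- The twins were incomparable and `v` ends up on top; after exchanging their names it is
      -- `none` that ends up on top.
      · apply TwinRel.of_relabelParent h h' hB hn hv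
        have h2 : IsElimTree _ (relabelParent (twinSwap G v) _) := h'.relabel
        have h3 := mt (inSubtree_twinSwap_some_none (G := G)).1 fun hc => by cases h'.antisymm hvn' hc
        rw [relabelParent_rotateParent] at h2 h3 ⊢
        refine TwinRel.of_not_above h.relabel h2 hB hn hv (relabelParent_eq_some.2 hb) ?_ h3
        rwa [inSubtree_twinSwap_some_none]
    · exact TwinRel.of_not_above h h' hB hn hv hb hvn hvn'
  by_cases hvn : InSubtree p (some v) none
  · apply TwinRel.of_relabelParent h h' hB hn hv
    have h2 : IsElimTree _ (relabelParent (twinSwap G v) _) := h'.relabel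
    rw [relabelParent_rotateParent] at h2 ⊢
    refine main h.relabel h2 (relabelParent_eq_some.2 hb) ?_
    rw [inSubtree_twinSwap_some_none]
    exact fun hc => by cases h.antisymm hvn hc
  · exact main h h' hb hvn

theorem IsElimTree.twinSplice (h : IsElimTree (addFalseTwin G v) p)
    (hB : IsJoinWith (addFalseTwin G v) B) (hn : none ∉ B) (hv : some v ∉ B) :
    IsElimTree G (twinSplice G v p) := by
  unfold _root_.twinSplice
  split_ifs with h1
  · refine h.relabel.splice hB hn hv ?_
    rw [inSubtree_twinSwap_some_none]
    exact fun hc => by cases h.antisymm h1 hc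
  · exact h.splice hB hn hv h1

theorem twinIndex_lt (p : Option V → Option (Option V)) : twinIndex v p < 3 := by
  unfold twinIndex
  split_ifs <;> omega

theorem colorable_addFalseTwin [Finite V] (hG : G.Connected)
    (hG' : (addFalseTwin G v).Connected) (hB : IsJoinWith (addFalseTwin G v) B) (hn : none ∉ B)
    (hv : some v ∉ B) {k : ℕ} (hk : 3 ≤ k) (hc : (rotationGraph G).Colorable k) :
    (rotationGraph (addFalseTwin G v)).Colorable k := by
  -- In `Fin (m + 3)` the indices 0, 1, 2 are distinct and addition is cancellative.
  obtain ⟨m, rfl⟩ := Nat.exists_eq_add_of_le' hk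
  obtain ⟨C⟩ := hc
  let F : SearchTree (addFalseTwin G v) → SearchTree G := fun T =>
    ((T.isElimTree hG').twinSplice hB hn hv).toSearchTree
  let e : SearchTree (addFalseTwin G v) → Fin (m + 3) := fun T =>
    ⟨twinIndex v T.parent, (twinIndex_lt _).trans_le hk⟩
  have key : ∀ T T' : SearchTree (addFalseTwin G v), T.Rotates T' →
      C (F T') + e T' ≠ C (F T) + e T := by
    rintro T T' ⟨a, b, hb, hT'⟩
    have h := T.isElimTree hG'
    have h' := T'.isElimTree hG'
    have hrel : TwinRel G v T.parent T'.parent := by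
      rw [hT'] at h' ⊢
      exact twinRel_rotateParent h h' hB hn hv hb
    obtain ⟨h1, h2⟩ | ⟨⟨c, d, hd, h1⟩, h2⟩ := hrel
    · have hF : F T' = F T := SearchTree.ext h1
      rw [hF]
      exact fun hc => h2 (Fin.ext_iff.1 (add_left_cancel hc))
    · have he : e T' = e T := Fin.ext h2
      rw [he]
      have hadj : (rotationGraph G).Adj (F T') (F T) :=
        (rotationGraph_adj hG).2 (Or.inr ⟨c, d, hd, h1⟩)
      exact fun hc => C.valid hadj (add_right_cancel hc)
  refine ⟨SimpleGraph.Coloring.mk (fun T => C (F T) + e T) ?_⟩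
  intro T T' hTT'
  obtain h | h := (rotationGraph_adj hG').1 hTT'
  · exact (key T T' h).symm
  · exact key T' T h

theorem colorable_of_addFalseTwin [Finite V] (hG : G.Connected) (hv : ∃ u, G.Adj v u) {k : ℕ}
    (hc : (rotationGraph (addFalseTwin G v)).Colorable k) : (rotationGraph G).Colorable k := by
  obtain ⟨C⟩ := hc
  have hG' := addFalseTwin_connected hG hv
  let F : SearchTree G → SearchTree (addFalseTwin G v) := fun T =>
    ((T.isElimTree hG).addRoot hv).toSearchTree
  have hF : ∀ T T' : SearchTree G, T.Rotates T' → (F T).Rotates (F T') := by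
    rintro T T' ⟨a, b, hb, hT'⟩
    refine ⟨some a, some b, congrArg some hb, ?_⟩
    change addRoot T'.parent = _
    rw [hT', addRoot_rotateParent (v := v)]
    rfl
  refine ⟨SimpleGraph.Coloring.mk (fun T => C (F T)) ?_⟩
  intro T T' hTT'
  refine C.valid ((rotationGraph_adj hG').2 ?_)
  exact ((rotationGraph_adj hG).1 hTT').imp (hF T T') (hF T' T)

end Twin

/-! ### The theorem. -/

theorem mainTheorem4 {V : Type*} [Finite V] (G : SimpleGraph V) (hconn : G.Connected)
    (hnc : G ≠ ⊤) (V₁ V₂ : Set V) (hpart : IsCompl V₁ V₂)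
    (hN : ∀ u ∈ V₁, G.neighborSet u = V₂) (v : V) (hv : v ∈ V₁) :
    (rotationGraph (addFalseTwin G v)).chromaticNumber = (rotationGraph G).chromaticNumber := by
  have hadj : ∀ u ∈ V₁, ∀ y, G.Adj u y ↔ y ∈ V₂ := fun u hu y => by
    rw [← SimpleGraph.mem_neighborSet, hN u hu]
  have hcompl : ∀ x, x ∉ V₂ → x ∈ V₁ := fun x hx => by
    rw [hpart.eq_compl]
    exact hx
  have hnot : ∀ x ∈ V₁, x ∉ V₂ := fun x hx => by
    rw [hpart.eq_compl] at hx
    exact hx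
  obtain ⟨a, b, hab, hnab⟩ : ∃ a b, a ≠ b ∧ ¬ G.Adj a b := by
    by_contra! hcon
    exact hnc (SimpleGraph.ext (by
      ext x y
      exact ⟨fun h => h.ne, fun h => hcon x y h⟩))
  have : Nontrivial V := ⟨a, b, hab⟩
  obtain ⟨u, hvu⟩ : ∃ u, G.Adj v u := hconn.preconnected.exists_adj_of_nontrivial v
  have hu : u ∈ V₂ := (hadj v hv u).1 hvu
  have h3 : ∀ k, (rotationGraph G).Colorable k → 3 ≤ k := by
    intro k hk
    have hdom : ∀ s t x, s ∈ V₁ → t ∈ V₂ → G.Adj x s ∨ G.Adj x t := by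
      intro s t x hs ht
      by_cases hx : x ∈ V₂
      · exact Or.inl ((hadj s hs x).2 hx).symm
      · exact Or.inr ((hadj x (hcompl x hx) t).2 ht)
    -- Nonadjacent `a` and `b` lie in the same part; any vertex of the other part is a common
    -- neighbour, and one vertex from each part already dominates.
    by_cases ha : a ∈ V₂
    · by_cases hb : b ∈ V₂
      · refine three_le_of_colorable hconn ((hadj v hv a).2 ha).symm ((hadj v hv b).2 hb).symm hab
          hnab (fun x => ?_) hk
        have := hdom v a x hv ha
        tauto
      · exact absurd ((hadj b (hcompl b hb) a).2 ha).symm hnab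
    · by_cases hb : b ∈ V₂
      · exact absurd ((hadj a (hcompl a ha) b).2 hb) hnab
      · refine three_le_of_colorable hconn ((hadj a (hcompl a ha) u).2 hu)
          ((hadj b (hcompl b hb) u).2 hu) hab hnab (fun x => ?_) hk
        have := hdom a u x (hcompl a ha) hu
        tauto
  have hvB : some v ∉ some '' V₂ := by
    rintro ⟨x, hx, hxv⟩
    exact hnot v hv (Option.some.inj hxv ▸ hx)
  have hnB : none ∉ some '' V₂ := by
    rintro ⟨x, -, hx⟩
    cases hx
  have hB : IsJoinWith (addFalseTwin G v) (some '' V₂) := by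
    rintro x hx y
    have hx1 : x.getD v ∈ V₁ := by
      obtain _ | x := x
      · exact hv
      · exact hcompl x fun h => hx ⟨x, h, rfl⟩
    rw [addFalseTwin_adj, hadj _ hx1]
    obtain _ | y := y
    · exact iff_of_false (hnot v hv) hnB
    · exact ⟨fun h => ⟨y, h, rfl⟩, fun ⟨z, hz, hzy⟩ => Option.some.inj hzy ▸ hz⟩
  apply le_antisymm
  · exact SimpleGraph.chromaticNumber_le_of_forall_imp fun k hk =>
      colorable_addFalseTwin hconn (addFalseTwin_connected hconn ⟨u, hvu⟩) hB hnB hvB (h3 k hk) hk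
  · exact SimpleGraph.chromaticNumber_le_of_forall_imp fun k hk =>
      colorable_of_addFalseTwin hconn ⟨u, hvu⟩ hk
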